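/- **Setting.** Let $G$ be a simple, connected, undirected graph with $n$ nodes and $m$ edges. Nodes are anonymous and have no memory; at each node $v$ the incident edges are numbered by ports $0,\dots,\delta(v)-1$, independently at the two ends of an edge. There are $n$ mobile agents, one starting at each node (its home), with pairwise distinct identifiers in $\{0,1,\dots\}$; $\lambda$ is the largest identifier, and $\lambda\le n^c$ for a constant $c\ge 1$. Every agent initially knows its identifier, $\lambda$, $m$, and whether it is the root agent $r^\star$. Time proceeds in synchronous rounds: in each round an agent exchanges memory contents (and entry ports) with the agents at the same node, computes, and then stays or moves through a port; it sees the degree of its node and the port through which it entered. Write $\log\lambda$ for the number of binary digits of $\lambda$, the length to which identifiers are padded. **Meeting with Neighbor.** Let $b$ be the identifier of an agent, padded with leading zeros to $\log\lambda$ bits, and let its new identifier be $(\sim b)\,\|\,b$, of $2\log\lambda$ bits. The protocol lasts $4\log\lambda$ rounds, two for each bit from the least to the most significant one. If the bit is $1$, an agent that wants to meet the neighbor behind port $p$ moves through $p$ in the first round and returns in the second; otherwise it stays at home for both rounds. An agent that does not want to meet anyone stays at home. **Flooding algorithm.** It consists of $2m$ consecutive executions of Meeting with Neighbor, followed by halting.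 Initially $r^\star$ has level $0$, all other agents have level $\bot$, and all parents are $\bot$. Whenever an agent gets a new level (for $r^\star$: at the beginning), it sends its level to its neighbors one by one in increasing order of ports, one neighbor per execution, beginning with port $0$ in the next execution. If an agent at home is visited in a round by agents sending their levels, let $\ell$ be the least of these; if its level is $\bot$ or larger than $\ell+1$, its level becomes $\ell+1$ and its parent (stored as a port number) becomes an arbitrary one of the visitors with level $\ell$. **Lemma.** For every way of making the arbitrary choices, the following hold. 1. If all agents simultaneously execute Meeting with Neighbor from their homes, each with an arbitrary target port or none, then every agent with a target port meets the agent living behind that port, at the latter's home, within $4\log\lambda$ rounds; after $4\log\lambda$ rounds all agents are back at their homes. Likewise, in each of the $2m$ executions within the flooding algorithm, every agent that sends its level to a neighbor in this execution meets that neighbor at the neighbor's home during this execution. 2. After $T=8m\log\lambda$ rounds all agents have halted, at their homes; thus the algorithm takes $O(m\log\lambda)$ rounds (for $\lambda\ge 2$, $T\le 16\,m\log_2\lambda$ with the real logarithm). 3. The algorithm correctly builds a BFS tree: after $T$ rounds the level of each agent is the distance in $G$ from the home of $r^\star$ to its own home; $r^\star$ has no parent; the parent port of every other agent leads to a node that is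 one step closer to the root; and the edges behind the parent ports form a spanning tree of $G$ in which each node has the same distance to the root as in $G$. 4. Each agent uses $O(\log n)$ bits of memory: there is a constant $K$ depending only on $c$ such that, if $n\ge 2$, then at all times each agent stores at most $K\log_2 n$ bits. -/

import Mathlib

namespace MobileAgent

/-! ### The network: anonymous graphs with port numbers -/

section Network

variable {V : Type*} [Fintype V]

/-- A port numbering of `G`: at each node `v`, the incident edges (equivalently, the neighbours of
`v`) are numbered bijectively by `0, …, δ(v) - 1`. The two ends of an edge are numbered
independently. -/
structure PortNumbering (G : SimpleGraph V) [DecidableRel G.Adj] where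
  equiv : ∀ v : V, G.neighborSet v ≃ Fin (G.degree v)

/-- The neighbour reached from `v` through port `p`; `none` if `v` has no port `p`. -/
def PortNumbering.dest {G : SimpleGraph V} [DecidableRel G.Adj] (π : PortNumbering G)
    (v : V) (p : ℕ) : Option (G.neighborSet v) :=
  if h : p < G.degree v then some ((π.equiv v).symm ⟨p, h⟩) else none

/-- The effect of a move decision at `v`: `none` means staying, `some p` leaving through port `p`.
The result is the new node, with the port through which it was entered (`none` after staying). -/
def PortNumbering.travel {G : SimpleGraph V} [DecidableRel G.Adj] (π : PortNumbering G)
    (v : V) (move : Option ℕ) : V × Option ℕ :=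
  match move.bind (π.dest v) with
  | none => (v, none)
  | some w => (w.1, some (π.equiv w.1 ⟨v, G.adj_symm w.2⟩ : ℕ))

/-- `T` is a breadth-first search tree of `G` rooted at `r`: a spanning tree of `G` in which every
node is as far from the root as it is in `G`. -/
def IsBFSTree (G T : SimpleGraph V) (r : V) : Prop :=
  T ≤ G ∧ T.IsTree ∧ ∀ v, T.dist r v = G.dist r v

end Network

/-! ### Bit strings stored by the agents -/

/-- A self-delimiting binary code of a list of bits. -/
def encodeBits : List Bool → List Bool
  | [] => [false]
  | b :: l => true :: b :: encodeBits l

/-- A self-delimiting binary code of a natural number, of length `2 * Nat.size k + 1`. -/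
def encodeNat (k : ℕ) : List Bool := encodeBits k.bits

/-- `none` is coded as `0` and `some k` as `k + 1`. -/
def optNat : Option ℕ → ℕ
  | none => 0
  | some k => k + 1

/-- The code of a list of registers. -/
def encodeRegisters : List ℕ → List Bool
  | [] => []
  | k :: l => encodeNat k ++ encodeRegisters l

theorem encodeBits_append_inj : ∀ {l l' x y : List Bool},
    encodeBits l ++ x = encodeBits l' ++ y → l = l' ∧ x = y
  | [], [], _, _, h => by simpa [encodeBits] using h
  | [], _ :: _, _, _, h => by simp [encodeBits] at h
  | _ :: _, [], _, _, h => by simp [encodeBits] at h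
  | b :: l, b' :: l', x, y, h => by
      simp only [encodeBits, List.cons_append, List.cons.injEq, true_and] at h
      obtain ⟨h1, h2⟩ := h
      obtain ⟨h3, h4⟩ := encodeBits_append_inj h2
      exact ⟨by rw [h1, h3], h4⟩

theorem bits_inj {a b : ℕ} (h : a.bits = b.bits) : a = b := by
  refine Nat.eq_of_testBit_eq fun i => ?_
  rw [Nat.testBit_eq_inth, Nat.testBit_eq_inth, h]

theorem encodeNat_append_inj {a b : ℕ} {x y : List Bool}
    (h : encodeNat a ++ x = encodeNat b ++ y) : a = b ∧ x = y := by
  obtain ⟨h1, h2⟩ := encodeBits_append_inj h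
  exact ⟨bits_inj h1, h2⟩

theorem encodeRegisters_inj : ∀ {l l' : List ℕ}, l.length = l'.length →
    encodeRegisters l = encodeRegisters l' → l = l'
  | [], [], _, _ => rfl
  | [], _ :: _, hl, _ => by simp at hl
  | _ :: _, [], hl, _ => by simp at hl
  | a :: l, b :: l', hl, h => by
      obtain ⟨h1, h2⟩ := encodeNat_append_inj h
      rw [h1, encodeRegisters_inj (by simpa using hl) h2]

theorem optNat_inj {a b : Option ℕ} (h : optNat a = optNat b) : a = b := by
  cases a <;> cases b <;> simp_all [optNat]

/-! ### Synchronous mobile agents with local communication -/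

/-- What an agent perceives in one round, besides its own memory: the degree of its current node,
the port through which it entered this node in the preceding round (`none` if it stayed), and, of
every other agent at this node, the memory content and the entry port. -/
structure View (σ : Type) where
  degree : ℕ
  entry : Option ℕ
  others : Multiset (σ × Option ℕ)

/-- A deterministic program, the same for all agents, for agents with initial knowledge in `I`.
In each round it maps the memory content and the view to the new memory content and a move
(`none`: stay; `some p`: leave through port `p`). `encode` writes the memory content in bits. -/
structure AgentProgram (I : Type) where
  State : Type
  encode : State → List Bool
  encode_injective : Function.Injective encode
  init : I → State
  step : State → View State → State × Option ℕ

/-- A configuration: position, entry port and memory content of every agent. -/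
structure Config (A V : Type*) (σ : Type) where
  pos : A → V
  entry : A → Option ℕ
  state : A → σ

section Execution

variable {V A : Type*} [Fintype V] [DecidableEq V] [Fintype A] [DecidableEq A] {I : Type}

/-- The view of agent `a` in a configuration. -/
def Config.view {σ : Type} (G : SimpleGraph V) [DecidableRel G.Adj] (C : Config A V σ) (a : A) :
    View σ where
  degree := G.degree (C.pos a)
  entry := C.entry a
  others := (Finset.univ.filter fun b => b ≠ a ∧ C.pos b = C.pos a).val.map
    fun b => (C.state b, C.entry b)

/-- One synchronous round (communicate, compute, move). -/
def AgentProgram.round (P : AgentProgram I) {G : SimpleGraph V} [DecidableRel G.Adj]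
    (π : PortNumbering G) (C : Config A V P.State) : Config A V P.State where
  pos a := (π.travel (C.pos a) (P.step (C.state a) (C.view G a)).2).1
  entry a := (π.travel (C.pos a) (P.step (C.state a) (C.view G a)).2).2
  state a := (P.step (C.state a) (C.view G a)).1

/-- The configuration after `t` rounds (equivalently, at the beginning of round `t`, rounds being
counted from `0`), where agent `a` starts at node `home a` with initial knowledge `input a`. -/
def AgentProgram.run (P : AgentProgram I) {G : SimpleGraph V} [DecidableRel G.Adj]
    (π : PortNumbering G) (home : A → V) (input : A → I) : ℕ → Config A V P.State
  | 0 => ⟨home, fun _ => none, fun a => P.init (input a)⟩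
  | t + 1 => P.round π (P.run π home input t)

/-- The number of bits that agent `a` stores in a configuration (memory content and entry port). -/
def AgentProgram.memoryBits (P : AgentProgram I) (C : Config A V P.State) (a : A) : ℕ :=
  (P.encode (C.state a)).length + (encodeNat (optNat (C.entry a))).length

end Execution

/-! ### The protocol "Meeting with Neighbor" -/

/-- The length to which all identifiers are padded when the largest one is `lam`: the number of
binary digits of `lam`. This is the meaning of `log λ` in round counts. -/
def idWidth (lam : ℕ) : ℕ := lam.size

/-- The `k`-th bit, counted from the least significant one and from `0`, of the `2 * L`-bit string
`(∼b) || b`, where `b` is `id` padded to `L` bits. -/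
def newIDBit (L id k : ℕ) : Bool :=
  if k < L then id.testBit k else !(id.testBit (k - L))

/-- The move in round `r` (`0 ≤ r < 4 * L`) of the protocol, for an agent that has to meet the
neighbour behind port `target` (`none`: the agent is not trying to meet anyone). In round `2 * k` it
leaves for the neighbour if the `k`-th bit of its new identifier is `1` and stays otherwise; in
round `2 * k + 1` it goes back through the port it came from, or stays if it has stayed. -/
def meetMove (L id : ℕ) (target : Option ℕ) (r : ℕ) (entry : Option ℕ) : Option ℕ :=
  if r % 2 = 0 then (if newIDBit L id (r / 2) then target else none) else entry

/-- Initial knowledge for a single execution of the protocol. -/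
structure MeetInput where
  id : ℕ
  maxId : ℕ
  target : Option ℕ

/-- Memory for a single execution of the protocol. -/
structure MeetState where
  id : ℕ
  maxId : ℕ
  target : Option ℕ
  clock : ℕ

/-- A single execution of "Meeting with Neighbor", lasting `4 * idWidth maxId` rounds. -/
def meetingProgram : AgentProgram MeetInput where
  State := MeetState
  encode s := encodeRegisters [s.id, s.maxId, optNat s.target, s.clock]
  encode_injective := by
    rintro ⟨_, _, _, _⟩ ⟨_, _, _, _⟩ h
    have h1 := encodeRegisters_inj (by simp) h
    simp only [List.cons.injEq, and_true] at h1
    obtain ⟨rfl, rfl, h2, rfl⟩ := h1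
    rw [optNat_inj h2]
  init x := ⟨x.id, x.maxId, x.target, 0⟩
  step s w :=
    if s.clock < 4 * idWidth s.maxId then
      ({ s with clock := s.clock + 1 },
        meetMove (idWidth s.maxId) s.id s.target s.clock w.entry)
    else (s, none)

/-! ### The flooding algorithm for BFS trees -/

/-- Initial knowledge: the agent's identifier, the largest identifier, the number of edges, and
whether the agent is the root agent. -/
structure FloodInput where
  id : ℕ
  maxId : ℕ
  edges : ℕ
  isRoot : Bool

/-- Memory of an agent. `clock` is the round number; `parent` is the port to the parent; `next` is
the next port to which the current level is still to be sent (`none`: there is nothing to send);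
`target` is the port behind which the agent is trying to meet its neighbour at present. -/
structure FloodState where
  id : ℕ
  maxId : ℕ
  edges : ℕ
  clock : ℕ
  level : Option ℕ
  parent : Option ℕ
  next : Option ℕ
  target : Option ℕ

/-- The number of rounds of one execution of "Meeting with Neighbor". -/
def FloodState.phaseLength (s : FloodState) : ℕ := 4 * idWidth s.maxId

/-- At the start of each execution of "Meeting with Neighbor", an agent that still has to announce
its level takes the next port, in increasing order; any other agent stays idle. -/
def FloodState.startPhase (degree : ℕ) (s : FloodState) : FloodState :=
  match s.next with
  | none => { s with target := none }
  | some q =>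
    if q < degree then { s with target := some q, next := some (q + 1) }
    else { s with target := none, next := none }

/-- The pairs (level, port of the host's node leading to the sender) announced by visitors. -/
def offers (others : Multiset (FloodState × Option ℕ)) : Finset (ℕ × ℕ) :=
  (others.filterMap fun x =>
    match x.1.level, x.2 with
    | some l, some p => some (l, p)
    | _, _ => none).toFinset

/-- An agent at home gets the levels of all agents visiting it in this round. If the least of these,
`l`, satisfies `l + 1 < level` or the agent has no level yet, then the new level is `l + 1`, the new
parent is a sender of `l` (chosen by `sel` if there are several), and the agent starts to announce
the new level, from port `0` on. -/
def FloodState.receive (sel : FloodState → Finset ℕ → ℕ) (s : FloodState)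
    (others : Multiset (FloodState × Option ℕ)) : FloodState :=
  if h : (offers others).Nonempty then
    let l := (offers others).inf' h Prod.fst
    if s.level = none ∨ ∃ k, s.level = some k ∧ l + 1 < k then
      { s with
        level := some (l + 1)
        parent := some (sel s (((offers others).filter fun x => x.1 = l).image Prod.snd))
        next := some 0 }
    else s
  else s

/-- One round of the flooding algorithm. The algorithm consists of `2 * edges` consecutive
executions of "Meeting with Neighbor" and then halts. Levels are received by agents that are at home
in the odd rounds (those in which the visitors are at their neighbours' nodes). -/
def FloodState.stepFlood (sel : FloodState → Finset ℕ → ℕ) (s : FloodState)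
    (w : View FloodState) : FloodState × Option ℕ :=
  if s.clock < 2 * s.edges * s.phaseLength then
    let r := s.clock % s.phaseLength
    let s₁ := if r = 0 then s.startPhase w.degree else s
    let s₂ := if r % 2 = 1 ∧ w.entry = none then s₁.receive sel w.others else s₁
    ({ s₂ with clock := s.clock + 1 }, meetMove (idWidth s.maxId) s.id s₁.target r w.entry)
  else (s, none)

/-- The flooding algorithm, where `sel` chooses among several possible parents. The root agent
starts with level `0`, to be announced from port `0` on; all others start with no level. -/
def floodingBFS (sel : FloodState → Finset ℕ → ℕ) : AgentProgram FloodInput where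
  State := FloodState
  encode s := encodeRegisters [s.id, s.maxId, s.edges, s.clock, optNat s.level, optNat s.parent,
    optNat s.next, optNat s.target]
  encode_injective := by
    rintro ⟨_, _, _, _, _, _, _, _⟩ ⟨_, _, _, _, _, _, _, _⟩ h
    have h1 := encodeRegisters_inj (by simp) h
    simp only [List.cons.injEq, and_true] at h1
    obtain ⟨rfl, rfl, rfl, rfl, h2, h3, h4, h5⟩ := h1
    rw [optNat_inj h2, optNat_inj h3, optNat_inj h4, optNat_inj h5]
  init x :=
    { id := x.id, maxId := x.maxId, edges := x.edges, clock := 0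
      level := if x.isRoot then some 0 else none
      parent := none
      next := if x.isRoot then some 0 else none
      target := none }
  step := FloodState.stepFlood sel

/-- A choice rule that always chooses one of the candidates. It may depend on everything the agent
knows (in particular on its identifier and on the round), so the choice is arbitrary. -/
def IsSelection (sel : FloodState → Finset ℕ → ℕ) : Prop :=
  ∀ s P, P.Nonempty → sel s P ∈ P

/-- The graph formed by the edges from the agents' home nodes through their parent ports. -/
def parentGraph {V A : Type*} [Fintype V] {G : SimpleGraph V} [DecidableRel G.Adj]
    (π : PortNumbering G) (home : A → V) (state : A → FloodState) : SimpleGraph V :=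
  SimpleGraph.fromRel fun v w => ∃ a p, home a = v ∧ (state a).parent = some p ∧
    (π.dest v p).map Subtype.val = some w

end MobileAgent

open MobileAgent

/-!
The meeting protocol works because two different identifiers differ in some bit, and each bit is
used once as it is and once complemented: hence, for any two adjacent agents, there is a bit at
which the first one leaves its home and the second one stays (`exists_newIDBit`). Every excursion
takes two rounds, so that agents are at home after every even number of rounds (`floodRun_pos`).

For the flooding algorithm, a level can never be smaller than the distance to the root, since it
exceeds the level of an adjacent agent by one when it is adopted (`isSound_floodRun`). Conversely,
an agent with level `l` that has served a port leaves an agent with level at most `l + 1` behind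
this port, because the two have met (`floodRun_informed_or_next`). Once the level of an agent equals
its distance, it never changes again and one further port is served in each execution
(`floodRun_settled_succ`). Therefore the levels along a shortest path from the root become right one
after the other, each after at most as many further executions as the preceding node has ports
(`exists_settled`). The degrees on a shortest path add up to at most `2 * m`, so `2 * m` executions
suffice (`floodRun_level_final`).

When a parent is stored, its level is one less than that of the agent. As the final level is the
distance, the parent is one step closer to the root. The edges to the parents then connect every
node to the root by a path of the right length, and as there are fewer such edges than nodes, they
form a tree (`isBFSTree_of_parent`). All registers hold numbers that are polynomial in the number of
nodes, which gives the bound on the memory (`memoryBits_floodRun_le`, `size_register_bound_le`).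
-/

namespace MobileAgent

/-! ### Port-numbered networks -/

section Network

variable {V : Type*} [Fintype V] {G : SimpleGraph V} [DecidableRel G.Adj] (π : PortNumbering G)

theorem PortNumbering.dest_equiv {v w : V} (h : G.Adj v w) :
    π.dest v (π.equiv v ⟨w, h⟩ : ℕ) = some ⟨w, h⟩ := by
  simp [PortNumbering.dest]

theorem PortNumbering.lt_degree_of_dest {v : V} {p : ℕ} {w : G.neighborSet v}
    (h : π.dest v p = some w) : p < G.degree v := by
  by_contra hp
  simp [PortNumbering.dest, hp] at h

theorem PortNumbering.exists_dest_of_adj {v w : V} (h : G.Adj v w) :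
    ∃ p < G.degree v, π.dest v p = some ⟨w, h⟩ :=
  ⟨_, (π.equiv v ⟨w, h⟩).2, π.dest_equiv h⟩

@[simp]
theorem PortNumbering.travel_none (v : V) : π.travel v none = (v, none) := rfl

theorem PortNumbering.travel_of_dest {v : V} {p : ℕ} {w : G.neighborSet v}
    (h : π.dest v p = some w) :
    π.travel v (some p) = (w.1, some (π.equiv w.1 ⟨v, G.adj_symm w.2⟩ : ℕ)) := by
  simp [PortNumbering.travel, h]

/-- Travelling either has no effect, or crosses an edge; in the latter case the entry port leads
back to the starting point. -/
theorem PortNumbering.travel_cases (v : V) (move : Option ℕ) :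
    π.travel v move = (v, none) ∨ ∃ p w, ∃ h : G.Adj w v, π.travel v move = (w, some p) ∧
      π.dest w p = some ⟨v, h⟩ := by
  rcases hm : move.bind (π.dest v) with _ | w
  · left
    simp [PortNumbering.travel, hm]
  · right
    refine ⟨_, w.1, G.adj_symm w.2, ?_, π.dest_equiv (G.adj_symm w.2)⟩
    simp only [PortNumbering.travel, hm]

theorem PortNumbering.dest_of_travel_eq_some {v w : V} {move : Option ℕ} {p : ℕ}
    (h : π.travel v move = (w, some p)) :
    ∃ h : G.Adj w v, π.dest w p = some ⟨v, h⟩ := by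
  rcases π.travel_cases v move with h' | ⟨p', w', hadj, h', hd⟩
  · simp [h'] at h
  · rw [h'] at h
    simp only [Prod.mk.injEq, Option.some.injEq] at h
    obtain ⟨rfl, rfl⟩ := h
    exact ⟨hadj, hd⟩

/-- Leaving through the entry port undoes the preceding move. -/
theorem PortNumbering.travel_back (v : V) (move : Option ℕ) :
    (π.travel (π.travel v move).1 (π.travel v move).2).1 = v := by
  rcases π.travel_cases v move with h' | ⟨p, w, hadj, h', hd⟩
  · simp [h']
  · rw [h', π.travel_of_dest hd]

theorem PortNumbering.lt_card_of_travel_eq_some {v : V} {move : Option ℕ} {p : ℕ}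
    (h : (π.travel v move).2 = some p) : p < Fintype.card V := by
  obtain ⟨hadj, hd⟩ := π.dest_of_travel_eq_some (w := (π.travel v move).1) (Prod.ext rfl h)
  exact (π.lt_degree_of_dest hd).trans (G.degree_lt_card_verts _)

end Network

/-! ### Distances and breadth-first search trees -/

theorem dist_le_dist_add_one {V : Type*} {G : SimpleGraph V} (hG : G.Connected) {u v w : V}
    (h : G.Adj v w) : G.dist u v ≤ G.dist u w + 1 := by
  have h1 := hG.dist_triangle (u := u) (v := w) (w := v)
  rwa [SimpleGraph.dist_eq_one_iff_adj.2 h.symm] at h1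

theorem exists_adj_dist_eq {V : Type*} {G : SimpleGraph V} (hG : G.Connected) {r v : V} {d : ℕ}
    (h : G.dist r v = d + 1) :
    ∃ w, G.Adj w v ∧ G.dist r w = d := by
  obtain ⟨p, hp⟩ := hG.exists_walk_length_eq_dist v r
  rw [SimpleGraph.dist_comm, h] at hp
  cases p with
  | nil => simp at hp
  | @cons _ w _ hadj p =>
    refine ⟨w, hadj.symm, le_antisymm ?_ ?_⟩
    · rw [SimpleGraph.dist_comm]
      simp only [SimpleGraph.Walk.length_cons, Nat.add_right_cancel_iff] at hp
      exact hp ▸ SimpleGraph.dist_le p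
    · have := dist_le_dist_add_one hG (u := r) hadj
      omega

/-- If every node but the root points to a neighbour one step closer to the root, then the edges
used form a breadth-first search tree: they connect every node to the root by a path of the right
length, and there are fewer edges than nodes. -/
theorem isBFSTree_of_parent {V : Type*} [Fintype V] {G T : SimpleGraph V} {r : V} (par : V → V)
    (hadj : ∀ v ≠ r, G.Adj v (par v)) (hdist : ∀ v ≠ r, G.dist r v = G.dist r (par v) + 1)
    (hT : ∀ v w, T.Adj v w ↔ (v ≠ r ∧ w = par v) ∨ (w ≠ r ∧ v = par w)) :
    IsBFSTree G T r := by
  classical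
  have hle : T ≤ G := by
    intro v w h
    rcases (hT v w).1 h with ⟨h1, rfl⟩ | ⟨h1, rfl⟩
    · exact hadj v h1
    · exact (hadj w h1).symm
  have hwalk : ∀ d v, G.dist r v = d → ∃ p : T.Walk v r, p.length = d := by
    intro d
    induction d with
    | zero =>
      intro v hv
      by_cases h : v = r
      · subst h
        exact ⟨.nil, rfl⟩
      · have := hdist v h
        omega
    | succ d ih =>
      intro v hv
      have h : v ≠ r := by
        rintro rfl
        simp at hv
      obtain ⟨p, hp⟩ := ih (par v) (by have := hdist v h; omega)
      exact ⟨.cons ((hT _ _).2 (Or.inl ⟨h, rfl⟩)) p, by simp [hp]⟩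
  have hreach : ∀ v, T.Reachable v r := fun v => (hwalk _ v rfl).choose.reachable
  have hconn : T.Connected :=
    { preconnected := fun v w => (hreach v).trans (hreach w).symm
      nonempty := ⟨r⟩ }
  refine ⟨hle, ?_, fun v => le_antisymm ?_ ((hreach v).symm.dist_anti hle)⟩
  · rw [SimpleGraph.isTree_iff_connected_and_card]
    refine ⟨hconn, le_antisymm ?_ hconn.card_vert_le_card_edgeSet_add_one⟩
    have hsub : T.edgeSet ⊆
        ((Finset.univ.erase r).image fun v => s(v, par v) : Finset (Sym2 V)) := by
      intro e
      induction e with | _ v w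
      intro h
      rw [SimpleGraph.mem_edgeSet, hT] at h
      simp only [Finset.coe_image, Set.mem_image, Finset.mem_coe, Finset.mem_erase,
        Finset.mem_univ, and_true]
      rcases h with ⟨h1, rfl⟩ | ⟨h1, rfl⟩
      · exact ⟨v, h1, rfl⟩
      · exact ⟨w, h1, Sym2.eq_swap⟩
    have h1 := Set.ncard_le_ncard hsub (Finset.finite_toSet _)
    rw [Set.ncard_coe_finset] at h1
    have h2 := h1.trans Finset.card_image_le
    rw [Finset.card_erase_of_mem (Finset.mem_univ r), Finset.card_univ] at h2
    have h3 : 0 < Fintype.card V := Fintype.card_pos_iff.2 ⟨r⟩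
    rw [Nat.card_coe_set_eq, Nat.card_eq_fintype_card]
    omega
  · obtain ⟨p, hp⟩ := hwalk _ v rfl
    rw [SimpleGraph.dist_comm, ← hp]
    exact SimpleGraph.dist_le p

/-- Parent ports that lead one step closer to the root form a breadth-first search tree. -/
theorem isBFSTree_parentGraph {V A : Type*} [Fintype V] {G : SimpleGraph V} [DecidableRel G.Adj]
    {π : PortNumbering G} {home : A ≃ V} {root : A} {state : A → FloodState}
    (hroot : (state root).parent = none)
    (hpar : ∀ a, a ≠ root → ∃ p w, (state a).parent = some p ∧ π.dest (home a) p = some w ∧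
      G.dist (home root) (home a) = G.dist (home root) w.1 + 1) :
    IsBFSTree G (parentGraph π home state) (home root) := by
  have hpar' : ∀ v, ∃ w, v ≠ home root → ∃ p, ∃ h : G.Adj v w,
      (state (home.symm v)).parent = some p ∧ π.dest v p = some ⟨w, h⟩ ∧
      G.dist (home root) v = G.dist (home root) w + 1 := by
    intro v
    obtain ⟨a, rfl⟩ := home.surjective v
    by_cases h : a = root
    · exact ⟨home a, fun h' => absurd (congrArg home h) h'⟩
    · obtain ⟨p, w, hp, hw, hd⟩ := hpar a h
      exact ⟨w.1, fun _ => ⟨p, w.2, by simpa using hp, hw, hd⟩⟩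
  choose par hpar' using hpar'
  have hrel : ∀ v w, (∃ a p, home a = v ∧ (state a).parent = some p ∧
      (π.dest v p).map Subtype.val = some w) ↔ v ≠ home root ∧ w = par v := by
    intro v w
    constructor
    · rintro ⟨a, p, rfl, hp, hw⟩
      have hne : home a ≠ home root := by
        intro h
        rw [home.injective h, hroot] at hp
        simp at hp
      obtain ⟨p', hadj, hp', hd, -⟩ := hpar' _ hne
      rw [Equiv.symm_apply_apply, hp] at hp'
      obtain rfl := Option.some.inj hp'
      rw [hd] at hw
      exact ⟨hne, (Option.some.inj hw).symm⟩
    · rintro ⟨hne, rfl⟩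
      obtain ⟨p, hadj, hp, hd, -⟩ := hpar' v hne
      exact ⟨home.symm v, p, by simp, hp, by rw [hd]; rfl⟩
  refine isBFSTree_of_parent par (fun v hv => (hpar' v hv).choose_spec.choose)
    (fun v hv => (hpar' v hv).choose_spec.choose_spec.2.2) fun v w => ?_
  rw [parentGraph, SimpleGraph.fromRel_adj, hrel, hrel]
  refine and_iff_right_of_imp ?_
  rintro (⟨hv, rfl⟩ | ⟨hw, rfl⟩)
  · exact (hpar' v hv).choose_spec.choose.ne
  · exact (hpar' w hw).choose_spec.choose.ne.symm

/-! ### Identifiers and code lengths -/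

/-- For two different identifiers there is a position at which the new identifier of the first has
bit `1` and that of the second has bit `0`: at a position where the identifiers differ, either the
original bits or the complemented ones are of this kind. -/
theorem exists_newIDBit {L x y : ℕ} (hx : x < 2 ^ L) (hy : y < 2 ^ L) (h : x ≠ y) :
    ∃ k < 2 * L, newIDBit L x k = true ∧ newIDBit L y k = false := by
  obtain ⟨i, hi⟩ : ∃ i, x.testBit i ≠ y.testBit i := by
    by_contra hcon
    push Not at hcon
    exact h (Nat.eq_of_testBit_eq hcon)
  have hiL : i < L := by
    by_contra hL
    have hpow : 2 ^ L ≤ 2 ^ i := Nat.pow_le_pow_right (by norm_num) (by omega)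
    rw [Nat.testBit_lt_two_pow (hx.trans_le hpow), Nat.testBit_lt_two_pow (hy.trans_le hpow)] at hi
    exact hi rfl
  cases hxi : x.testBit i <;> cases hyi : y.testBit i
  · simp [hxi, hyi] at hi
  · exact ⟨L + i, by omega, by simp [newIDBit, hxi], by simp [newIDBit, hyi]⟩
  · exact ⟨i, by omega, by simp [newIDBit, hiL, hxi], by simp [newIDBit, hiL, hyi]⟩
  · simp [hxi, hyi] at hi

theorem lt_two_pow_idWidth {x lam : ℕ} (h : x ≤ lam) : x < 2 ^ idWidth lam :=
  h.trans_lt (Nat.lt_size_self lam)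

theorem length_encodeBits (l : List Bool) : (encodeBits l).length = 2 * l.length + 1 := by
  induction l with
  | nil => rfl
  | cons b l ih => simp only [encodeBits, List.length_cons, ih]; ring

theorem length_encodeNat (k : ℕ) : (encodeNat k).length = 2 * k.size + 1 := by
  rw [encodeNat, length_encodeBits, Nat.size_eq_bits_len]

theorem length_encodeRegisters_le {B : ℕ} (l : List ℕ) (h : ∀ k ∈ l, k ≤ B) :
    (encodeRegisters l).length ≤ l.length * (2 * B.size + 1) := by
  induction l with
  | nil => simp [encodeRegisters]
  | cons k l ih =>
    have h1 := ih fun k hk => h k (List.mem_cons_of_mem _ hk)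
    have h2 := Nat.size_le_size (h k List.mem_cons_self)
    simp only [encodeRegisters, List.length_append, length_encodeNat, List.length_cons, add_mul]
    omega

theorem size_le_logb_add_one {k : ℕ} (hk : 1 ≤ k) : (k.size : ℝ) ≤ Real.logb 2 k + 1 := by
  have hs : 0 < k.size := Nat.size_pos.2 hk
  have h : 2 ^ (k.size - 1) ≤ k := Nat.lt_size.1 (by omega)
  have h' : (2 : ℝ) ^ ((k.size - 1 : ℕ) : ℝ) ≤ k := by
    rw [Real.rpow_natCast]
    exact_mod_cast h
  have := (Real.le_logb_iff_rpow_le (by norm_num) (by positivity)).2 h'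
  rw [Nat.cast_sub hs] at this
  push_cast at this
  linarith

theorem size_le_two_mul_logb {k : ℕ} (hk : 2 ≤ k) : (k.size : ℝ) ≤ 2 * Real.logb 2 k := by
  have h1 := size_le_logb_add_one (k := k) (by omega)
  have h2 : 1 ≤ Real.logb 2 (k : ℝ) := by
    rw [Real.le_logb_iff_rpow_le (by norm_num) (by positivity)]
    simpa using (show (2 : ℝ) ≤ k by exact_mod_cast hk)
  linarith

/-! ### A single execution of the meeting protocol -/

section Meeting

variable {V A : Type*} [Fintype V] [DecidableEq V] [Fintype A] [DecidableEq A]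
  {G : SimpleGraph V} [DecidableRel G.Adj] (π : PortNumbering G) (home : A → V)
  (input : A → MeetInput)

theorem meetingProgram_run_succ_of_lt {t : ℕ} {a : A}
    (hs : (meetingProgram.run π home input t).state a =
      (⟨(input a).id, (input a).maxId, (input a).target, t⟩ : MeetState))
    (ht : t < 4 * idWidth (input a).maxId) :
    meetingProgram.step ((meetingProgram.run π home input t).state a)
        ((meetingProgram.run π home input t).view G a) =
      ((⟨(input a).id, (input a).maxId, (input a).target, t + 1⟩ : MeetState),
        meetMove (idWidth (input a).maxId) (input a).id (input a).target t
          ((meetingProgram.run π home input t).entry a)) := by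
  rw [hs]
  simp only [meetingProgram, ht, if_true]
  rfl

/-- During the protocol, agents are at home after an even number of rounds; after an odd number of
rounds, they are where the current bit of their new identifier sends them. -/
theorem meetingProgram_run (a : A) (t : ℕ) (ht : t ≤ 4 * idWidth (input a).maxId) :
    (meetingProgram.run π home input t).state a =
      (⟨(input a).id, (input a).maxId, (input a).target, t⟩ : MeetState) ∧
    (t % 2 = 0 → (meetingProgram.run π home input t).pos a = home a) ∧
    (t % 2 = 1 → ((meetingProgram.run π home input t).pos a,
      (meetingProgram.run π home input t).entry a) = π.travel (home a)
        (if newIDBit (idWidth (input a).maxId) (input a).id (t / 2) then (input a).target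
          else none)) := by
  induction t with
  | zero => exact ⟨rfl, fun _ => rfl, by simp⟩
  | succ t ih =>
    obtain ⟨hs, h0, h1⟩ := ih (by omega)
    have hstep := meetingProgram_run_succ_of_lt π home input hs (by omega)
    have hst : (meetingProgram.run π home input (t + 1)).state a =
        (meetingProgram.step ((meetingProgram.run π home input t).state a)
        ((meetingProgram.run π home input t).view G a)).1 := rfl
    have hpos : ((meetingProgram.run π home input (t + 1)).pos a,
        (meetingProgram.run π home input (t + 1)).entry a) =
        π.travel ((meetingProgram.run π home input t).pos a)
        (meetingProgram.step ((meetingProgram.run π home input t).state a)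
        ((meetingProgram.run π home input t).view G a)).2 := rfl
    rw [hstep] at hst hpos
    refine ⟨hst, fun ht' => ?_, fun ht' => ?_⟩
    · have htr := h1 (by omega)
      have hp : (meetingProgram.run π home input t).pos a = _ := congrArg Prod.fst htr
      have he : (meetingProgram.run π home input t).entry a = _ := congrArg Prod.snd htr
      have hpos' := congrArg Prod.fst hpos
      simp only [meetMove, show ¬ t % 2 = 0 by omega, if_false] at hpos'
      rw [hpos', hp, he, π.travel_back]
    · rw [hpos, h0 (by omega)]
      simp only [meetMove, show t % 2 = 0 by omega, if_true, show (t + 1) / 2 = t / 2 by omega]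

/-- If the first of two adjacent agents leaves at a bit at which the second stays, they meet. -/
theorem meetingProgram_meets {a b : A} {p : ℕ} (hmax : (input a).maxId = (input b).maxId)
    (ha : (input a).id ≤ (input a).maxId) (hb : (input b).id ≤ (input b).maxId)
    (hab : (input a).id ≠ (input b).id) (hp : (input a).target = some p)
    (hd : (π.dest (home a) p).map Subtype.val = some (home b)) :
    ∃ t < 4 * idWidth (input a).maxId, (meetingProgram.run π home input t).pos a = home b ∧
      (meetingProgram.run π home input t).pos b = home b := by
  obtain ⟨k, hk, hka, hkb⟩ := exists_newIDBit (lt_two_pow_idWidth ha)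
    (hmax ▸ lt_two_pow_idWidth hb) hab
  obtain ⟨w, hw, hwb⟩ := Option.map_eq_some_iff.1 hd
  have h2 : (2 * k + 1) / 2 = k := by omega
  have h1 := (meetingProgram_run π home input a (2 * k + 1) (by omega)).2.2 (by omega)
  have h3 := (meetingProgram_run π home input b (2 * k + 1) (by rw [← hmax]; omega)).2.2 (by omega)
  rw [h2, hka, if_pos rfl, hp, π.travel_of_dest hw] at h1
  rw [h2, ← hmax, hkb] at h3
  exact ⟨2 * k + 1, by omega, (congrArg Prod.fst h1).trans hwb, congrArg Prod.fst h3⟩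

end Meeting

/-! ### One step of the flooding algorithm -/

theorem FloodState.startPhase_target_of_next {s : FloodState} {d q : ℕ} (h : s.next = some q)
    (hq : q < d) : (s.startPhase d).target = some q ∧ (s.startPhase d).next = some (q + 1) := by
  simp [FloodState.startPhase, h, hq]

/-- Starting an execution of the protocol changes nothing but `next` and `target`. -/
theorem FloodState.startPhase_eq (s : FloodState) (d : ℕ) :
    s.startPhase d =
      { s with target := (s.startPhase d).target, next := (s.startPhase d).next } := by
  unfold FloodState.startPhase
  split
  · rfl
  · split <;> rfl

/-- `next` never decreases at the start of an execution: it is incremented or discarded. -/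
theorem FloodState.startPhase_next (s : FloodState) (d q : ℕ)
    (h : (s.startPhase d).next = some q) : ∃ q', s.next = some q' ∧ q = q' + 1 ∧ q' < d := by
  unfold FloodState.startPhase at h
  split at h
  · simp_all
  · split at h
    · simp_all
    · simp at h

theorem FloodState.startPhase_target_lt (s : FloodState) (d q : ℕ)
    (h : (s.startPhase d).target = some q) : q < d := by
  unfold FloodState.startPhase at h
  split at h
  · simp at h
  · split at h
    · simp_all
    · simp at h

theorem mem_offers {others : Multiset (FloodState × Option ℕ)} {l p : ℕ} :
    (l, p) ∈ offers others ↔ ∃ s, (s, some p) ∈ others ∧ s.level = some l := by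
  simp only [offers, Multiset.mem_toFinset, Multiset.mem_filterMap, Prod.exists]
  constructor
  · rintro ⟨s, e, hmem, h⟩
    split at h
    · simp only [Option.some.injEq, Prod.mk.injEq] at h
      obtain ⟨rfl, rfl⟩ := h
      exact ⟨s, hmem, ‹_›⟩
    · simp at h
  · rintro ⟨s, hmem, hl⟩
    exact ⟨s, some p, hmem, by simp [hl]⟩

/-- Either no offer improves the level of the host, or the host adopts a least offer. -/
theorem FloodState.receive_cases {sel : FloodState → Finset ℕ → ℕ} (hsel : IsSelection sel)
    (s : FloodState) (others : Multiset (FloodState × Option ℕ)) :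
    (s.receive sel others = s ∧
      ∀ l p, (l, p) ∈ offers others → ∃ k, s.level = some k ∧ k ≤ l + 1) ∨
    ∃ l p, (l, p) ∈ offers others ∧ (∀ l' p', (l', p') ∈ offers others → l ≤ l') ∧
      (∀ k, s.level = some k → l + 1 < k) ∧
      s.receive sel others =
        { s with level := some (l + 1), parent := some p, next := some 0 } := by
  by_cases h : (offers others).Nonempty
  · set l := (offers others).inf' h Prod.fst with hl
    have hmin : ∀ l' p', (l', p') ∈ offers others → l ≤ l' := fun l' p' h' =>
      Finset.inf'_le (f := Prod.fst) h'
    by_cases hc : s.level = none ∨ ∃ k, s.level = some k ∧ l + 1 < k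
    · right
      have hne : (((offers others).filter fun x => x.1 = l).image Prod.snd).Nonempty := by
        obtain ⟨x, hx, hxl⟩ := Finset.exists_mem_eq_inf' h Prod.fst
        exact ⟨x.2, Finset.mem_image_of_mem _ (Finset.mem_filter.2 ⟨hx, hxl.symm⟩)⟩
      obtain ⟨x, hx, hxs⟩ := Finset.mem_image.1 (hsel s _ hne)
      obtain ⟨hx, hxl⟩ := Finset.mem_filter.1 hx
      refine ⟨l, x.2, ?_, hmin, ?_, ?_⟩
      · rw [← hxl]
        exact hx
      · intro k hk
        rcases hc with hc | ⟨k', hk', hlt⟩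
        · simp [hk] at hc
        · rw [hk] at hk'
          obtain rfl := Option.some.inj hk'
          exact hlt
      · simp only [FloodState.receive, h, dif_pos, ← hl, if_pos hc, hxs]
    · left
      refine ⟨by simp only [FloodState.receive, h, dif_pos, ← hl, if_neg hc], fun l' p' h' => ?_⟩
      push Not at hc
      obtain ⟨k, hk⟩ := Option.ne_none_iff_exists'.1 hc.1
      exact ⟨k, hk, (hc.2 k hk).trans (Nat.succ_le_succ (hmin l' p' h'))⟩
  · left
    refine ⟨by simp only [FloodState.receive, h, dif_neg, not_false_iff], fun l p hlp => ?_⟩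
    exact absurd ⟨_, hlp⟩ h

/-! ### Runs of the flooding algorithm -/

/-- An execution lasts an even number of rounds, so the parity of a round within its execution is
the parity of the round. -/
theorem mod_phase_mod_two (t L : ℕ) : t % (4 * L) % 2 = t % 2 :=
  Nat.mod_mod_of_dvd t (Dvd.intro (2 * L) (by ring))

theorem succ_mod_phase {t L : ℕ} (hL : 0 < L) (ht : t % 2 = 0) :
    (t + 1) % (4 * L) = t % (4 * L) + 1 := by
  have h1 := mod_phase_mod_two t L
  have h2 := Nat.mod_lt t (show 0 < 4 * L by omega)
  rw [Nat.add_mod, Nat.mod_eq_of_lt (show 1 < 4 * L by omega), Nat.mod_eq_of_lt (by omega)]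

section Flood

variable {V A : Type*} [Fintype V] [DecidableEq V] [Fintype A] [DecidableEq A]
  {G : SimpleGraph V} [DecidableRel G.Adj] (sel : FloodState → Finset ℕ → ℕ)
  (π : PortNumbering G) (home : A ≃ V) (ID : A → ℕ) (lam m : ℕ) (root : A)

/-- The run of the flooding algorithm in which `m` is given to the agents as number of edges. -/
def floodRun : ℕ → Config A V FloodState :=
  (floodingBFS sel).run π home fun a => ⟨ID a, lam, m, decide (a = root)⟩

local notation "𝓡" => floodRun sel π home ID lam m root

/-- The knowledge an agent starts with is never changed, and its clock runs until it halts. -/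
theorem floodRun_const (t : ℕ) (a : A) :
    ((𝓡 t).state a).id = ID a ∧ ((𝓡 t).state a).maxId = lam ∧ ((𝓡 t).state a).edges = m ∧
      ((𝓡 t).state a).clock = min t (2 * m * (4 * idWidth lam)) := by
  induction t with
  | zero => exact ⟨rfl, rfl, rfl, by simp [floodRun, AgentProgram.run, floodingBFS]⟩
  | succ t ih =>
    have hst : (𝓡 (t + 1)).state a =
        (((𝓡 t).state a).stepFlood sel ((𝓡 t).view G a)).1 := rfl
    rw [hst]
    generalize (𝓡 t).state a = s at ih
    generalize (𝓡 t).view G a = w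
    obtain ⟨h1, h2, h3, h4⟩ := ih
    have hrec : ∀ (s : FloodState) o, (s.receive sel o).id = s.id ∧
        (s.receive sel o).maxId = s.maxId ∧ (s.receive sel o).edges = s.edges := by
      intro s o
      unfold FloodState.receive
      split
      · dsimp only
        split <;> exact ⟨rfl, rfl, rfl⟩
      · exact ⟨rfl, rfl, rfl⟩
    have hstart : ∀ (s : FloodState) d, (s.startPhase d).id = s.id ∧
        (s.startPhase d).maxId = s.maxId ∧ (s.startPhase d).edges = s.edges := by
      intro s d
      rw [s.startPhase_eq]
      exact ⟨rfl, rfl, rfl⟩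
    unfold FloodState.stepFlood FloodState.phaseLength
    rw [h2, h3, h4]
    split
    · dsimp only
      refine ⟨?_, ?_, ?_, by omega⟩ <;> split <;> split <;> simp [hrec, hstart, h1, h2, h3]
    · exact ⟨h1, h2, h3, by change s.clock = _; omega⟩

/-- The effect of one round before halting. -/
theorem floodRun_stepFlood {t : ℕ} (ht : t < 2 * m * (4 * idWidth lam)) (a : A) :
    ((𝓡 t).state a).stepFlood sel ((𝓡 t).view G a) =
      (let r := t % (4 * idWidth lam)
      let s := (𝓡 t).state a
      let s₁ := if r = 0 then s.startPhase (G.degree ((𝓡 t).pos a)) else s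
      let s₂ := if r % 2 = 1 ∧ (𝓡 t).entry a = none then
        s₁.receive sel ((𝓡 t).view G a).others else s₁
      ({ s₂ with clock := t + 1 },
        meetMove (idWidth lam) (ID a) s₁.target r ((𝓡 t).entry a))) := by
  obtain ⟨h1, h2, h3, h4⟩ := floodRun_const sel π home ID lam m root t a
  rw [min_eq_left ht.le] at h4
  unfold FloodState.stepFlood FloodState.phaseLength
  simp only [h1, h2, h3, h4, if_pos ht, Config.view]

/-- Before halting, agents are at home after an even number of rounds; after an odd number of
rounds, they are where the current bit of their new identifier sends them. -/
theorem floodRun_pos (a : A) {t : ℕ} (ht : t ≤ 2 * m * (4 * idWidth lam)) :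
    (t % 2 = 0 → (𝓡 t).pos a = home a) ∧
    (t % 2 = 1 → ((𝓡 t).pos a, (𝓡 t).entry a) = π.travel (home a)
      (if newIDBit (idWidth lam) (ID a) (t % (4 * idWidth lam) / 2) then
        ((𝓡 t).state a).target else none)) := by
  induction t with
  | zero => exact ⟨fun _ => rfl, by simp⟩
  | succ t ih =>
    obtain ⟨h0, h1⟩ := ih (by omega)
    have hL : 0 < idWidth lam := by
      by_contra hL
      simp [show idWidth lam = 0 by omega] at ht
    have hstep := floodRun_stepFlood sel π home ID lam m root (show t < _ by omega) a
    have hst : (𝓡 (t + 1)).state a =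
        (((𝓡 t).state a).stepFlood sel ((𝓡 t).view G a)).1 := rfl
    have hpos : ((𝓡 (t + 1)).pos a, (𝓡 (t + 1)).entry a) = π.travel ((𝓡 t).pos a)
        (((𝓡 t).state a).stepFlood sel ((𝓡 t).view G a)).2 := rfl
    rw [hstep] at hst hpos
    have hmod := mod_phase_mod_two t (idWidth lam)
    refine ⟨fun ht' => ?_, fun ht' => ?_⟩
    · have htr := h1 (by omega)
      have hp : (𝓡 t).pos a = _ := congrArg Prod.fst htr
      have he : (𝓡 t).entry a = _ := congrArg Prod.snd htr
      have hpos' := congrArg Prod.fst hpos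
      simp only [meetMove, hmod, show ¬ t % 2 = 0 by omega, if_false] at hpos'
      rw [hpos', hp, he, π.travel_back]
    · have ht0 : t % 2 = 0 := by omega
      rw [hpos, h0 ht0, hst, succ_mod_phase hL ht0]
      have hdiv : (t % (4 * idWidth lam) + 1) / 2 = t % (4 * idWidth lam) / 2 := by omega
      simp only [meetMove, hmod, ht0, if_true, hdiv, zero_ne_one, false_and, if_false]
      rw [h0 ht0]

theorem floodRun_pos_of_even (a : A) {t : ℕ} (ht : t ≤ 2 * m * (4 * idWidth lam))
    (h : t % 2 = 0) : (𝓡 t).pos a = home a :=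
  (floodRun_pos sel π home ID lam m root a ht).1 h

theorem floodRun_succ_of_mod_eq_zero (a : A) {t : ℕ} (ht : t < 2 * m * (4 * idWidth lam))
    (h : t % (4 * idWidth lam) = 0) :
    (𝓡 (t + 1)).state a =
      { ((𝓡 t).state a).startPhase (G.degree (home a)) with clock := t + 1 } := by
  have hst : (𝓡 (t + 1)).state a =
    (((𝓡 t).state a).stepFlood sel ((𝓡 t).view G a)).1 := rfl
  have hmod := mod_phase_mod_two t (idWidth lam)
  rw [hst, floodRun_stepFlood sel π home ID lam m root ht,
    floodRun_pos_of_even sel π home ID lam m root a ht.le (by omega)]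
  simp [h]

theorem floodRun_succ_of_mod_ne_zero (a : A) {t : ℕ} (ht : t < 2 * m * (4 * idWidth lam))
    (h : t % (4 * idWidth lam) ≠ 0) (h' : ¬ (t % 2 = 1 ∧ (𝓡 t).entry a = none)) :
    (𝓡 (t + 1)).state a = { (𝓡 t).state a with clock := t + 1 } := by
  have hst : (𝓡 (t + 1)).state a =
    (((𝓡 t).state a).stepFlood sel ((𝓡 t).view G a)).1 := rfl
  rw [hst, floodRun_stepFlood sel π home ID lam m root ht]
  simp only [h, if_false, mod_phase_mod_two, h']

theorem floodRun_succ_of_host (a : A) {t : ℕ} (ht : t < 2 * m * (4 * idWidth lam))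
    (h : t % 2 = 1) (he : (𝓡 t).entry a = none) :
    (𝓡 (t + 1)).state a =
      { ((𝓡 t).state a).receive sel ((𝓡 t).view G a).others with clock := t + 1 } := by
  have hst : (𝓡 (t + 1)).state a =
    (((𝓡 t).state a).stepFlood sel ((𝓡 t).view G a)).1 := rfl
  have hmod := mod_phase_mod_two t (idWidth lam)
  rw [hst, floodRun_stepFlood sel π home ID lam m root ht]
  simp only [show t % (4 * idWidth lam) ≠ 0 by omega, if_false, hmod, h, he, and_self, if_true]

/-- An agent at home during an odd round is offered exactly the levels of its visitors. -/
theorem mem_offers_view {a : A} {t l p : ℕ} (ht : t ≤ 2 * m * (4 * idWidth lam))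
    (h : t % 2 = 1) (he : (𝓡 t).entry a = none) :
    (l, p) ∈ offers ((𝓡 t).view G a).others ↔
      ∃ b, (𝓡 t).pos b = home a ∧ (𝓡 t).entry b = some p ∧ ((𝓡 t).state b).level = some l := by
  have hpos : (𝓡 t).pos a = home a := by
    have h1 := (floodRun_pos sel π home ID lam m root a ht).2 h
    rcases π.travel_cases (home a) _ with h2 | ⟨p, w, hadj, h2, -⟩
    · rw [h2] at h1
      exact congrArg Prod.fst h1
    · rw [h2] at h1
      have h3 : (𝓡 t).entry a = some p := congrArg Prod.snd h1
      simp [he] at h3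
  rw [mem_offers]
  simp only [Config.view, Multiset.mem_map, Finset.mem_val, Finset.mem_filter, Finset.mem_univ,
    true_and, Prod.mk.injEq, hpos]
  constructor
  · rintro ⟨s, ⟨b, ⟨-, hb⟩, rfl, hbe⟩, hl⟩
    exact ⟨b, hb, hbe, hl⟩
  · rintro ⟨b, hb, hbe, hl⟩
    refine ⟨_, ⟨b, ⟨?_, hb⟩, rfl, hbe⟩, hl⟩
    rintro rfl
    simp [he] at hbe

/-- An entry port leads from the host's node to the visitor's home. -/
theorem floodRun_dest_of_entry {a b : A} {t p : ℕ} (ht : t ≤ 2 * m * (4 * idWidth lam))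
    (h : t % 2 = 1) (hb : (𝓡 t).pos b = home a) (hp : (𝓡 t).entry b = some p) :
    ∃ hadj : G.Adj (home a) (home b), π.dest (home a) p = some ⟨home b, hadj⟩ := by
  have h1 := (floodRun_pos sel π home ID lam m root b ht).2 h
  rw [hb, hp] at h1
  exact π.dest_of_travel_eq_some h1.symm

/-- Except at the start of an execution, a round either changes nothing but the clock or makes the
agent adopt the level of an adjacent agent. -/
theorem floodRun_succ_cases (hsel : IsSelection sel) (a : A) {t : ℕ}
    (ht : t < 2 * m * (4 * idWidth lam)) (h : t % (4 * idWidth lam) ≠ 0) :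
    (𝓡 (t + 1)).state a = { (𝓡 t).state a with clock := t + 1 } ∨
    ∃ l p b, ∃ hadj : G.Adj (home a) (home b), π.dest (home a) p = some ⟨home b, hadj⟩ ∧
      ((𝓡 t).state b).level = some l ∧ (∀ k, ((𝓡 t).state a).level = some k → l + 1 < k) ∧
      (𝓡 (t + 1)).state a = { (𝓡 t).state a with
        level := some (l + 1), parent := some p, next := some 0, clock := t + 1 } := by
  by_cases h' : t % 2 = 1 ∧ (𝓡 t).entry a = none
  · obtain ⟨h1, he⟩ := h'
    rw [floodRun_succ_of_host sel π home ID lam m root a ht h1 he]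
    rcases FloodState.receive_cases hsel ((𝓡 t).state a) ((𝓡 t).view G a).others with
      ⟨hr, -⟩ | ⟨l, p, hmem, -, hlt, hr⟩
    · left
      rw [hr]
    · right
      obtain ⟨b, hb, hbe, hbl⟩ := (mem_offers_view sel π home ID lam m root ht.le h1 he).1 hmem
      obtain ⟨hadj, hd⟩ := floodRun_dest_of_entry sel π home ID lam m root ht.le h1 hb hbe
      exact ⟨l, p, b, hadj, hd, hbl, hlt, by rw [hr]⟩
  · exact Or.inl (floodRun_succ_of_mod_ne_zero sel π home ID lam m root a ht h h')

/-- A host's level exceeds that of a visitor by at most one after the visit. -/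
theorem floodRun_level_of_visit (hsel : IsSelection sel) {a b : A} {t l p : ℕ}
    (ht : t < 2 * m * (4 * idWidth lam)) (h : t % 2 = 1) (he : (𝓡 t).entry a = none)
    (hb : (𝓡 t).pos b = home a) (hp : (𝓡 t).entry b = some p)
    (hl : ((𝓡 t).state b).level = some l) :
    ∃ l' ≤ l + 1, ((𝓡 (t + 1)).state a).level = some l' := by
  have hmem := (mem_offers_view sel π home ID lam m root ht.le h he).2 ⟨b, hb, hp, hl⟩
  rw [floodRun_succ_of_host sel π home ID lam m root a ht h he]
  rcases FloodState.receive_cases hsel ((𝓡 t).state a) ((𝓡 t).view G a).others with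
    ⟨hr, hle⟩ | ⟨l', p', -, hle, -, hr⟩
  · obtain ⟨k, hk, hkl⟩ := hle _ _ hmem
    exact ⟨k, hkl, by rw [hr]; exact hk⟩
  · exact ⟨l' + 1, Nat.succ_le_succ (hle _ _ hmem), by rw [hr]⟩

/-! ### Soundness of levels, parents and ports -/

/-- An invariant of the memory `s` of the agent living at `v` after `t` rounds, where `r` is the
home of the root agent. A level is at least the distance to the root and at most `t`; the root agent
keeps level `0` and no parent; the parent port of any other agent with level `l` leads to a node at
distance less than `l`; and all registers holding ports are bounded by the degree (`next` may be one
past the last port). -/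
structure IsSound (π : PortNumbering G) (r v : V) (t : ℕ) (s : FloodState) : Prop where
  le_level : ∀ l, s.level = some l → G.dist r v ≤ l
  level_le : ∀ l, s.level = some l → l ≤ t
  of_root : v = r → s.level = some 0 ∧ s.parent = none
  of_ne_root : v ≠ r → ∀ l, s.level = some l →
    ∃ p w, s.parent = some p ∧ π.dest v p = some w ∧ G.dist r w.1 + 1 ≤ l
  parent_lt : ∀ p, s.parent = some p → p < G.degree v
  next_le : ∀ q, s.next = some q → q ≤ G.degree v
  target_lt : ∀ q, s.target = some q → q < G.degree v

/-- Soundness is preserved in every round before halting. -/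
theorem isSound_floodRun (hsel : IsSelection sel) (hG : G.Connected) {t : ℕ}
    (ht : t ≤ 2 * m * (4 * idWidth lam)) (a : A) :
    IsSound π (home root) (home a) t ((𝓡 t).state a) := by
  induction t generalizing a with
  | zero =>
    have hst : (𝓡 0).state a = (⟨ID a, lam, m, 0,
      if decide (a = root) then some 0 else none, none,
      if decide (a = root) then some 0 else none, none⟩ : FloodState) := rfl
    rw [hst]
    by_cases h : a = root
    · subst h
      constructor <;> simp
    · have h' : home a ≠ home root := fun h' => h (home.injective h')
      constructor <;> simp [h]
  | succ t ih =>
    have hs := ih (by omega) a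
    by_cases h0 : t % (4 * idWidth lam) = 0
    · rw [floodRun_succ_of_mod_eq_zero sel π home ID lam m root a (by omega) h0]
      have hst := ((𝓡 t).state a).startPhase_eq (G.degree (home a))
      have hl := congrArg FloodState.level hst
      have hp := congrArg FloodState.parent hst
      simp only at hl hp
      constructor
      · simpa only [hl] using hs.le_level
      · simp only [hl]
        exact fun l h => (hs.level_le l h).trans (Nat.le_succ t)
      · simpa only [hl, hp] using hs.of_root
      · simpa only [hl, hp] using hs.of_ne_root
      · simpa only [hp] using hs.parent_lt
      · intro q hq
        obtain ⟨q', -, rfl, hq'⟩ := FloodState.startPhase_next _ _ _ hq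
        exact hq'
      · exact fun q hq => FloodState.startPhase_target_lt _ _ _ hq
    · rcases floodRun_succ_cases sel π home ID lam m root hsel a (by omega) h0 with
        h | ⟨l, p, b, hadj, hd, hbl, hlt, h⟩
      · rw [h]
        exact ⟨hs.le_level, fun l h => (hs.level_le l h).trans (Nat.le_succ t), hs.of_root,
          hs.of_ne_root, hs.parent_lt, hs.next_le, hs.target_lt⟩
      · rw [h]
        have hsb := ih (by omega) b
        have hbd := hsb.le_level l hbl
        have hbt := hsb.level_le l hbl
        refine ⟨?_, ?_, ?_, ?_, ?_, by simp, hs.target_lt⟩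
        · rintro _ ⟨⟩
          exact (dist_le_dist_add_one hG hadj).trans (Nat.succ_le_succ hbd)
        · rintro _ ⟨⟩
          omega
        · intro hr
          have := hlt 0 (hs.of_root hr).1
          omega
        · rintro - _ ⟨⟩
          exact ⟨p, _, rfl, hd, Nat.succ_le_succ hbd⟩
        · rintro _ ⟨⟩
          exact π.lt_degree_of_dest hd

/-! ### One execution of the meeting protocol within the algorithm -/

variable {sel π home ID lam m root}

theorem phase_end_le {L k : ℕ} (hk : k < 2 * m) : k * (4 * L) + 4 * L ≤ 2 * m * (4 * L) := by
  calc k * (4 * L) + 4 * L = (k + 1) * (4 * L) := by ring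
    _ ≤ _ := Nat.mul_le_mul_right _ hk

theorem phase_mod {F k r : ℕ} (h : r < F) : (k * F + r) % F = r := by
  rw [Nat.mul_add_mod', Nat.mod_eq_of_lt h]

/-- In each execution the target port is fixed at the start. -/
theorem floodRun_target (hsel : IsSelection sel) (a : A) {k r : ℕ} (hk : k < 2 * m) (hr : 1 ≤ r)
    (hr' : r ≤ 4 * idWidth lam) :
    ((𝓡 (k * (4 * idWidth lam) + r)).state a).target =
      ((𝓡 (k * (4 * idWidth lam) + 1)).state a).target := by
  have hN := phase_end_le (L := idWidth lam) hk
  induction r, hr using Nat.le_induction with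
  | base => rfl
  | succ r hr ih =>
    rw [← ih (by omega), ← add_assoc]
    rcases floodRun_succ_cases sel π home ID lam m root hsel a
      (t := k * (4 * idWidth lam) + r) (by omega) (by rw [phase_mod (by omega)]; omega) with
      h | ⟨l, p, b, hadj, hd, hbl, hlt, h⟩ <;> rw [h]

/-- The situation during the execution `k` when an agent leaves for its target at bit `j`. -/
theorem floodRun_excursion (hsel : IsSelection sel) (a : A) {k j p : ℕ} (hk : k < 2 * m)
    (hj : j < 2 * idWidth lam) {w : G.neighborSet (home a)}
    (ht : ((𝓡 (k * (4 * idWidth lam) + 1)).state a).target = some p)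
    (hd : π.dest (home a) p = some w) (hbit : newIDBit (idWidth lam) (ID a) j = true) :
    (𝓡 (k * (4 * idWidth lam) + (2 * j + 1))).pos a = w.1 ∧
      ∃ p', (𝓡 (k * (4 * idWidth lam) + (2 * j + 1))).entry a = some p' := by
  have hN := phase_end_le (L := idWidth lam) hk
  have hmod := phase_mod (k := k) (show 2 * j + 1 < 4 * idWidth lam by omega)
  have hpar := mod_phase_mod_two (k * (4 * idWidth lam) + (2 * j + 1)) (idWidth lam)
  rw [hmod] at hpar
  have h1 := (floodRun_pos sel π home ID lam m root a
    (t := k * (4 * idWidth lam) + (2 * j + 1)) (by omega)).2 (by omega)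
  rw [hmod, show (2 * j + 1) / 2 = j by omega, hbit, if_pos rfl,
    floodRun_target hsel a hk (by omega) (by omega), ht, π.travel_of_dest hd] at h1
  exact ⟨congrArg Prod.fst h1, _, congrArg Prod.snd h1⟩

/-- The situation during the execution `k` when an agent stays at home at bit `j`. -/
theorem floodRun_stay (a : A) {k j : ℕ} (hk : k < 2 * m)
    (hj : j < 2 * idWidth lam) (hbit : newIDBit (idWidth lam) (ID a) j = false) :
    (𝓡 (k * (4 * idWidth lam) + (2 * j + 1))).pos a = home a ∧
      (𝓡 (k * (4 * idWidth lam) + (2 * j + 1))).entry a = none := by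
  have hN := phase_end_le (L := idWidth lam) hk
  have hmod := phase_mod (k := k) (show 2 * j + 1 < 4 * idWidth lam by omega)
  have hpar := mod_phase_mod_two (k * (4 * idWidth lam) + (2 * j + 1)) (idWidth lam)
  rw [hmod] at hpar
  have h1 := (floodRun_pos sel π home ID lam m root a
    (t := k * (4 * idWidth lam) + (2 * j + 1)) (by omega)).2 (by omega)
  rw [hmod, show (2 * j + 1) / 2 = j by omega, hbit] at h1
  exact ⟨congrArg Prod.fst h1, congrArg Prod.snd h1⟩

/-! ### Every level is announced to all neighbours -/

/-- Levels never increase. -/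
theorem floodRun_level_succ (hsel : IsSelection sel) (a : A) {t l : ℕ}
    (ht : t < 2 * m * (4 * idWidth lam)) (hl : ((𝓡 t).state a).level = some l) :
    ∃ l' ≤ l, ((𝓡 (t + 1)).state a).level = some l' := by
  by_cases h0 : t % (4 * idWidth lam) = 0
  · rw [floodRun_succ_of_mod_eq_zero sel π home ID lam m root a (by omega) h0,
      FloodState.startPhase_eq]
    exact ⟨l, le_rfl, hl⟩
  · rcases floodRun_succ_cases sel π home ID lam m root hsel a (by omega) h0 with
      h | ⟨l', p, b, hadj, hd, hbl, hlt, h⟩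
    · rw [h]
      exact ⟨l, le_rfl, hl⟩
    · rw [h]
      exact ⟨l' + 1, (hlt l hl).le, rfl⟩

/-- The invariant carried through an execution: after `r ≥ 1` rounds, for each port of an agent with
a level, either the neighbour's level is good enough, or the port is still to be served in a later
execution, or it is the present target and the two agents have not met so far. -/
theorem floodRun_informed_or_pending (hsel : IsSelection sel) (a b : A) {k p : ℕ}
    {hadj : G.Adj (home a) (home b)} (hk : k < 2 * m)
    (hd : π.dest (home a) p = some ⟨home b, hadj⟩)
    (h0 : ∀ l, ((𝓡 (k * (4 * idWidth lam))).state a).level = some l →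
      (∃ l' ≤ l + 1, ((𝓡 (k * (4 * idWidth lam))).state b).level = some l') ∨
      ∃ q ≤ p, ((𝓡 (k * (4 * idWidth lam))).state a).next = some q)
    {r : ℕ} (hr : 1 ≤ r) (hr' : r ≤ 4 * idWidth lam) (l : ℕ)
    (hl : ((𝓡 (k * (4 * idWidth lam) + r)).state a).level = some l) :
    (∃ l' ≤ l + 1, ((𝓡 (k * (4 * idWidth lam) + r)).state b).level = some l') ∨
    (∃ q ≤ p, ((𝓡 (k * (4 * idWidth lam) + r)).state a).next = some q) ∨
    (((𝓡 (k * (4 * idWidth lam) + r)).state a).target = some p ∧ ∀ j, 2 * j + 1 < r →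
      ¬ (newIDBit (idWidth lam) (ID a) j = true ∧ newIDBit (idWidth lam) (ID b) j = false)) := by
  have hN := phase_end_le (L := idWidth lam) hk
  induction r, hr using Nat.le_induction generalizing l with
  | base =>
    have hm : k * (4 * idWidth lam) % (4 * idWidth lam) = 0 := Nat.mul_mod_left _ _
    have hpd := π.lt_degree_of_dest hd
    rw [floodRun_succ_of_mod_eq_zero sel π home ID lam m root a (by omega) hm] at hl ⊢
    rw [floodRun_succ_of_mod_eq_zero sel π home ID lam m root b (by omega) hm]
    rw [FloodState.startPhase_eq] at hl
    rcases h0 l hl with ⟨l', hl', hb⟩ | ⟨q, hq, hn⟩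
    · left
      rw [FloodState.startPhase_eq]
      exact ⟨l', hl', hb⟩
    · right
      obtain ⟨h1, h2⟩ := FloodState.startPhase_target_of_next hn (hq.trans_lt hpd)
      rcases hq.eq_or_lt with rfl | hq
      · exact Or.inr ⟨h1, fun j hj => by omega⟩
      · exact Or.inl ⟨q + 1, hq, h2⟩
  | succ r hr ih =>
    rw [← add_assoc] at hl ⊢
    have hmod := phase_mod (k := k) (show r < 4 * idWidth lam by omega)
    have hlt : k * (4 * idWidth lam) + r < 2 * m * (4 * idWidth lam) := by omega
    rcases floodRun_succ_cases sel π home ID lam m root hsel a hlt (by omega) with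
      h | ⟨l', p', b', hadj', hd', hbl, hlt', h⟩
    · rw [h] at hl ⊢
      rcases ih (by omega) l hl with ⟨l', hl', hb⟩ | hn | ⟨ht, hj⟩
      · obtain ⟨l'', hl'', hb'⟩ := floodRun_level_succ hsel b hlt hb
        exact Or.inl ⟨l'', hl''.trans hl', hb'⟩
      · exact Or.inr (Or.inl hn)
      · by_cases hmeet : ∃ j, r = 2 * j + 1 ∧ newIDBit (idWidth lam) (ID a) j = true ∧
          newIDBit (idWidth lam) (ID b) j = false
        · -- The agent is visiting its neighbour in this round.
          obtain ⟨j, rfl, hja, hjb⟩ := hmeet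
          rw [floodRun_target hsel a hk (by omega) (by omega)] at ht
          obtain ⟨hpos, q, hq⟩ := floodRun_excursion hsel a hk (by omega) ht hd hja
          have hbe := (floodRun_stay (sel := sel) (π := π) (home := home) (root := root) b hk
            (by omega) hjb).2
          have hpar := mod_phase_mod_two (k * (4 * idWidth lam) + (2 * j + 1)) (idWidth lam)
          exact Or.inl (floodRun_level_of_visit sel π home ID lam m root hsel hlt (by omega) hbe
            hpos hq hl)
        · refine Or.inr (Or.inr ⟨ht, fun j hj' hbits => ?_⟩)
          rcases (show 2 * j + 1 < r ∨ r = 2 * j + 1 by omega) with hj'' | hj''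
          · exact hj j hj'' hbits
          · exact hmeet ⟨j, hj'', hbits⟩
    · right
      left
      rw [h]
      exact ⟨0, Nat.zero_le p, rfl⟩

/-- At the beginning of each execution, all neighbours of an agent with level `l` behind the ports
already served have level at most `l + 1`. -/
theorem floodRun_informed_or_next (hsel : IsSelection sel) (hID : Function.Injective ID)
    (hlam : ∀ a, ID a ≤ lam) {k : ℕ} (hk : k ≤ 2 * m) (a b : A) {p l : ℕ}
    {hadj : G.Adj (home a) (home b)} (hd : π.dest (home a) p = some ⟨home b, hadj⟩)
    (hl : ((𝓡 (k * (4 * idWidth lam))).state a).level = some l) :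
    (∃ l' ≤ l + 1, ((𝓡 (k * (4 * idWidth lam))).state b).level = some l') ∨
      ∃ q ≤ p, ((𝓡 (k * (4 * idWidth lam))).state a).next = some q := by
  induction k generalizing l with
  | zero =>
    right
    rw [zero_mul] at hl ⊢
    have hst : (𝓡 0).state a = (⟨ID a, lam, m, 0,
      if decide (a = root) then some 0 else none, none,
      if decide (a = root) then some 0 else none, none⟩ : FloodState) := rfl
    rw [hst] at hl ⊢
    by_cases h : a = root
    · exact ⟨0, Nat.zero_le p, by simp [h]⟩
    · simp [h] at hl
  | succ k ih =>
    have hne : ID a ≠ ID b := fun h => hadj.ne (congrArg home (hID h))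
    obtain ⟨j, hj, hja, hjb⟩ := exists_newIDBit (lt_two_pow_idWidth (hlam a))
      (lt_two_pow_idWidth (hlam b)) hne
    rw [Nat.succ_mul] at hl ⊢
    rcases floodRun_informed_or_pending hsel a b (by omega) hd (fun l hl => ih (by omega) hl)
      (by omega) le_rfl l hl with h | h | ⟨-, h⟩
    · exact Or.inl h
    · exact Or.inr h
    · exact absurd ⟨hja, hjb⟩ (h j (by omega))

/-! ### The levels become distances -/

/-- An agent whose level is its distance keeps it, and serves one port in each execution. -/
theorem floodRun_settled_succ (hsel : IsSelection sel) (hG : G.Connected)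
    (hL : 0 < idWidth lam) {k : ℕ} (hk : k < 2 * m) (a : A)
    (hl : ((𝓡 (k * (4 * idWidth lam))).state a).level = some (G.dist (home root) (home a))) :
    ((𝓡 ((k + 1) * (4 * idWidth lam))).state a).level = some (G.dist (home root) (home a)) ∧
    ∀ q, ((𝓡 ((k + 1) * (4 * idWidth lam))).state a).next = some q →
      ∃ q', ((𝓡 (k * (4 * idWidth lam))).state a).next = some q' ∧ q = q' + 1 := by
  have hN := phase_end_le (L := idWidth lam) hk
  have hmain : ∀ r, 1 ≤ r → r ≤ 4 * idWidth lam →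
      ((𝓡 (k * (4 * idWidth lam) + r)).state a).level = some (G.dist (home root) (home a)) ∧
      ∀ q, ((𝓡 (k * (4 * idWidth lam) + r)).state a).next = some q →
        ∃ q', ((𝓡 (k * (4 * idWidth lam))).state a).next = some q' ∧ q = q' + 1 := by
    intro r hr hr'
    induction r, hr using Nat.le_induction with
    | base =>
      rw [floodRun_succ_of_mod_eq_zero sel π home ID lam m root a (by omega)
        (Nat.mul_mod_left _ _)]
      refine ⟨?_, fun q hq => ?_⟩
      · rw [FloodState.startPhase_eq]
        exact hl
      · obtain ⟨q', hq', rfl, -⟩ := FloodState.startPhase_next _ _ _ hq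
        exact ⟨q', hq', rfl⟩
    | succ r hr ih =>
      obtain ⟨h1, h2⟩ := ih (by omega)
      have hmod := phase_mod (k := k) (show r < 4 * idWidth lam by omega)
      rw [← add_assoc]
      rcases floodRun_succ_cases sel π home ID lam m root hsel a
        (t := k * (4 * idWidth lam) + r) (by omega) (by omega) with
        h | ⟨l, p, b, hadj, hd, hbl, hlt, h⟩
      · rw [h]
        exact ⟨h1, h2⟩
      · -- No neighbour offers a level below the distance.
        have h3 := hlt _ h1
        have h4 := (isSound_floodRun sel π home ID lam m root hsel hG
          (t := k * (4 * idWidth lam) + r) (by omega) b).le_level l hbl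
        have h5 := dist_le_dist_add_one hG (u := home root) hadj
        omega
  rw [Nat.succ_mul]
  exact hmain _ (by omega) le_rfl

/-- An agent at distance `d` has the right level as soon as the number of executions is at least
the sum of the degrees of suitable nodes at distances less than `d` (those on a shortest path). -/
theorem exists_settled (hsel : IsSelection sel) (hG : G.Connected) (hID : Function.Injective ID)
    (hlam : ∀ a, ID a ≤ lam) (d : ℕ) (b : A) (hb : G.dist (home root) (home b) = d) :
    ∃ S : Finset V, (∀ u ∈ S, G.dist (home root) u < d) ∧
      ∀ k, ∑ u ∈ S, G.degree u ≤ k → k ≤ 2 * m →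
        ((𝓡 (k * (4 * idWidth lam))).state b).level = some d := by
  induction d generalizing b with
  | zero =>
    refine ⟨∅, by simp, fun k _ hk => ?_⟩
    exact ((isSound_floodRun sel π home ID lam m root hsel hG
      (Nat.mul_le_mul_right _ hk) b).of_root (hG.dist_eq_zero_iff.1 hb).symm).1
  | succ d ih =>
    obtain ⟨w, hadj, hw⟩ := exists_adj_dist_eq hG hb
    obtain ⟨a, rfl⟩ := home.surjective w
    obtain ⟨S, hS, hset⟩ := ih a hw
    have haS : home a ∉ S := fun h => by
      have := hS _ h
      omega
    have hL : 0 < idWidth lam := by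
      have hne : ID a ≠ ID b := fun h => hadj.ne (congrArg home (hID h))
      obtain ⟨j, hj, -⟩ := exists_newIDBit (lt_two_pow_idWidth (hlam a))
        (lt_two_pow_idWidth (hlam b)) hne
      omega
    refine ⟨insert (home a) S, fun u hu => ?_, fun k hk hkm => ?_⟩
    · rcases Finset.mem_insert.1 hu with rfl | hu
      · omega
      · exact (hS u hu).trans (Nat.lt_succ_self d)
    · rw [Finset.sum_insert haS] at hk
      set s := ∑ u ∈ S, G.degree u
      -- Since the level of `a` has become right, at least one port is served in each execution.
      have hnext : ∀ j, s + j ≤ 2 * m → ∀ q,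
          ((𝓡 ((s + j) * (4 * idWidth lam))).state a).next = some q → j ≤ q := by
        intro j
        induction j with
        | zero => exact fun _ q _ => Nat.zero_le q
        | succ j ihj =>
          intro hj q hq
          have hl := hset (s + j) (by omega) (by omega)
          rw [← hw] at hl
          obtain ⟨q', hq', rfl⟩ :=
            (floodRun_settled_succ hsel hG hL (k := s + j) (by omega) a hl).2 q hq
          exact Nat.succ_le_succ (ihj (by omega) q' hq')
      have hla := hset k (by omega) hkm
      obtain ⟨p, hp, hd⟩ := π.exists_dest_of_adj hadj
      obtain ⟨j, rfl⟩ := Nat.exists_eq_add_of_le (show s ≤ k by omega)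
      rcases floodRun_informed_or_next hsel hID hlam hkm a b hd hla with ⟨l, hl, hlb⟩ | ⟨q, hq, hn⟩
      · have := (isSound_floodRun sel π home ID lam m root hsel hG
          (Nat.mul_le_mul_right _ hkm) b).le_level l hlb
        rw [hlb, show l = d + 1 by omega]
      · have := hnext j hkm q hn
        omega

/-- After all executions, every level is a distance: the degrees of all nodes add up to `2 * m`. -/
theorem floodRun_level_final (hsel : IsSelection sel) (hG : G.Connected)
    (hID : Function.Injective ID) (hlam : ∀ a, ID a ≤ lam) (hm : m = G.edgeFinset.card) (a : A) :
    ((𝓡 (2 * m * (4 * idWidth lam))).state a).level = some (G.dist (home root) (home a)) := by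
  obtain ⟨S, -, hS⟩ := exists_settled (sel := sel) (π := π) (m := m) hsel hG hID hlam _ a rfl
  refine hS _ ?_ le_rfl
  rw [hm, ← G.sum_degrees_eq_twice_card_edges]
  exact Finset.sum_le_sum_of_subset (Finset.subset_univ S)

theorem floodRun_parent_final (hsel : IsSelection sel) (hG : G.Connected)
    (hID : Function.Injective ID) (hlam : ∀ a, ID a ≤ lam) (hm : m = G.edgeFinset.card) (a : A)
    (ha : a ≠ root) :
    ∃ p w, ((𝓡 (2 * m * (4 * idWidth lam))).state a).parent = some p ∧
      π.dest (home a) p = some w ∧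
      G.dist (home root) (home a) = G.dist (home root) w.1 + 1 := by
  obtain ⟨p, w, hp, hw, hle⟩ := (isSound_floodRun sel π home ID lam m root hsel hG
    le_rfl a).of_ne_root (fun h => ha (home.injective h)) _
    (floodRun_level_final hsel hG hID hlam hm a)
  exact ⟨p, w, hp, hw, le_antisymm (dist_le_dist_add_one hG w.2) hle⟩

/-! ### Meetings, halting and memory -/

theorem floodRun_meets (hsel : IsSelection sel) (hID : Function.Injective ID)
    (hlam : ∀ a, ID a ≤ lam) {k : ℕ} (hk : k < 2 * m) {a b : A} {p : ℕ}
    (ht : ((𝓡 (k * (4 * idWidth lam) + 1)).state a).target = some p)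
    (hd : (π.dest (home a) p).map Subtype.val = some (home b)) :
    ∃ t, k * (4 * idWidth lam) < t ∧ t < (k + 1) * (4 * idWidth lam) ∧
      (𝓡 t).pos a = home b ∧ (𝓡 t).pos b = home b := by
  obtain ⟨w, hw, hwb⟩ := Option.map_eq_some_iff.1 hd
  have hne : ID a ≠ ID b := by
    intro h
    obtain rfl := hID h
    exact w.2.ne hwb.symm
  obtain ⟨j, hj, hja, hjb⟩ := exists_newIDBit (lt_two_pow_idWidth (hlam a))
    (lt_two_pow_idWidth (hlam b)) hne
  refine ⟨k * (4 * idWidth lam) + (2 * j + 1), by omega, by rw [add_one_mul]; omega, ?_, ?_⟩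
  · rw [(floodRun_excursion hsel a hk hj ht hw hja).1, hwb]
  · exact (floodRun_stay b hk hj hjb).1

/-- After the last execution, nothing changes any more. -/
theorem floodRun_halted (a : A) {t : ℕ} (ht : 2 * m * (4 * idWidth lam) ≤ t) :
    (𝓡 t).pos a = home a ∧ (𝓡 t).state a = (𝓡 (2 * m * (4 * idWidth lam))).state a := by
  induction t, ht using Nat.le_induction with
  | base =>
    refine ⟨floodRun_pos_of_even sel π home ID lam m root a le_rfl ?_, rfl⟩
    rw [show 2 * m * (4 * idWidth lam) = 2 * (m * (4 * idWidth lam)) by ring]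
    exact Nat.mul_mod_right _ _
  | succ t ht ih =>
    have hstep : ((𝓡 t).state a).stepFlood sel ((𝓡 t).view G a) = ((𝓡 t).state a, none) := by
      obtain ⟨-, h2, h3, h4⟩ := floodRun_const sel π home ID lam m root t a
      unfold FloodState.stepFlood FloodState.phaseLength
      rw [h2, h3, h4, min_eq_right ht, if_neg (lt_irrefl _)]
    have hst : (𝓡 (t + 1)).state a =
      (((𝓡 t).state a).stepFlood sel ((𝓡 t).view G a)).1 := rfl
    have hpos : (𝓡 (t + 1)).pos a = (π.travel ((𝓡 t).pos a)
      (((𝓡 t).state a).stepFlood sel ((𝓡 t).view G a)).2).1 := rfl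
    rw [hst, hpos, hstep]
    exact ih

theorem floodRun_entry_lt (a : A) {t p : ℕ} (h : (𝓡 t).entry a = some p) :
    p < Fintype.card V := by
  cases t with
  | zero => cases h
  | succ t => exact π.lt_card_of_travel_eq_some h

theorem optNat_le {o : Option ℕ} {B : ℕ} (h : ∀ k, o = some k → k + 1 ≤ B) : optNat o ≤ B := by
  cases o with
  | none => exact Nat.zero_le B
  | some k => exact h k rfl

/-- All eight registers and the entry port are bounded by a polynomial in the size of the network
and the largest identifier; the dominant one is the clock, which stops at `2 * m` executions. -/
theorem memoryBits_floodRun_le (hsel : IsSelection sel) (hG : G.Connected)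
    (hlam : ∀ a, ID a ≤ lam) (hm : m = G.edgeFinset.card) (t : ℕ) (a : A) :
    (floodingBFS sel).memoryBits (𝓡 t) a ≤
      9 * (2 * (4 * Fintype.card V ^ 2 * (lam + 1) + Fintype.card V + 1).size + 1) := by
  set n := Fintype.card V with hn
  set B := 4 * n ^ 2 * (lam + 1) + n + 1 with hB
  have hdeg : ∀ v, G.degree v < n := fun v => G.degree_lt_card_verts v
  have h2m : 2 * m ≤ n ^ 2 := by
    rw [hm, ← G.sum_degrees_eq_twice_card_edges, sq]
    calc ∑ v, G.degree v ≤ ∑ _v : V, n := Finset.sum_le_sum fun v _ => (hdeg v).le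
      _ = n * n := by simp [hn]
  have hn0 : 1 ≤ n := (Nat.zero_le _).trans_lt (hdeg (home a))
  have hT : 2 * m * (4 * idWidth lam) ≤ 4 * n ^ 2 * (lam + 1) := by
    have hw : idWidth lam ≤ lam := Nat.size_le.2 Nat.lt_two_pow_self
    calc 2 * m * (4 * idWidth lam) ≤ n ^ 2 * (4 * (lam + 1)) := by gcongr; omega
      _ = 4 * n ^ 2 * (lam + 1) := by ring
  have hlamB : lam ≤ B := by nlinarith [Nat.one_le_pow 2 n hn0]
  have hmB : m ≤ B := by nlinarith [Nat.zero_le (n ^ 2 * lam)]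
  have hstate : (𝓡 t).state a = (𝓡 (min t (2 * m * (4 * idWidth lam)))).state a := by
    rcases le_total t (2 * m * (4 * idWidth lam)) with h | h
    · rw [min_eq_left h]
    · rw [min_eq_right h, (floodRun_halted a h).2]
  have hs := isSound_floodRun sel π home ID lam m root hsel hG
    (min_le_right t (2 * m * (4 * idWidth lam))) a
  rw [← hstate] at hs
  obtain ⟨h1, h2, h3, h4⟩ := floodRun_const sel π home ID lam m root t a
  have hd := hdeg (home a)
  have hreg := length_encodeRegisters_le (B := B) [((𝓡 t).state a).id, ((𝓡 t).state a).maxId,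
    ((𝓡 t).state a).edges, ((𝓡 t).state a).clock, optNat ((𝓡 t).state a).level,
    optNat ((𝓡 t).state a).parent, optNat ((𝓡 t).state a).next, optNat ((𝓡 t).state a).target] (by
      have hmin := min_le_right t (2 * m * (4 * idWidth lam))
      simp only [List.mem_cons, List.not_mem_nil, or_false, h1, h2, h3, h4]
      rintro k (rfl | rfl | rfl | rfl | rfl | rfl | rfl | rfl)
      · exact (hlam a).trans hlamB
      · exact hlamB
      · exact hmB
      · omega
      · exact optNat_le fun k hk => by have := hs.level_le k hk; omega
      · exact optNat_le fun k hk => by have := hs.parent_lt k hk; omega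
      · exact optNat_le fun k hk => by have := hs.next_le k hk; omega
      · exact optNat_le fun k hk => by have := hs.target_lt k hk; omega)
  have hent : (encodeNat (optNat ((𝓡 t).entry a))).length ≤ 2 * B.size + 1 := by
    rw [length_encodeNat]
    have := Nat.size_le_size (optNat_le (o := (𝓡 t).entry a) (B := B) fun k hk => by
      have := floodRun_entry_lt a hk
      omega)
    omega
  calc (floodingBFS sel).memoryBits (𝓡 t) a ≤ 8 * (2 * B.size + 1) + (2 * B.size + 1) :=
        Nat.add_le_add hreg hent
    _ = 9 * (2 * B.size + 1) := by ring

end Flood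

/-- A polynomial bound on the largest identifier turns the register size into `O(log n)`. -/
theorem size_register_bound_le {c : ℝ} (hc : 1 ≤ c) {n lam : ℕ} (hn : 2 ≤ n)
    (h : (lam : ℝ) ≤ (n : ℝ) ^ c) :
    ((4 * n ^ 2 * (lam + 1) + n + 1).size : ℝ) ≤ (c + 7) * Real.logb 2 n := by
  have hn' : (2 : ℝ) ≤ n := by exact_mod_cast hn
  have h1 : 1 ≤ Real.logb 2 (n : ℝ) := by
    rw [Real.le_logb_iff_rpow_le (by norm_num) (by positivity)]
    simpa using hn'
  have hx : (n : ℝ) ≤ (n : ℝ) ^ c := by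
    simpa using Real.rpow_le_rpow_of_exponent_le (by linarith : (1 : ℝ) ≤ n) hc
  have hB : ((4 * n ^ 2 * (lam + 1) + n + 1 : ℕ) : ℝ) ≤ 2 ^ (4 : ℝ) * (n : ℝ) ^ (c + 2) := by
    have h16 : (2 : ℝ) ^ (4 : ℝ) = 16 := by norm_num
    rw [h16, Real.rpow_add (by linarith), Real.rpow_two]
    push_cast
    generalize (n : ℝ) ^ c = x at h hx
    have h2 : (n : ℝ) ^ 2 * (lam + 1) ≤ (n : ℝ) ^ 2 * (2 * x) := by gcongr; linarith
    have h3 : x ≤ x * (n : ℝ) ^ 2 := le_mul_of_one_le_right (by linarith) (by nlinarith)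
    nlinarith
  have h2 := size_le_logb_add_one (k := 4 * n ^ 2 * (lam + 1) + n + 1) (by omega)
  have h3 := Real.logb_le_logb_of_le (b := 2) (by norm_num) (by positivity) hB
  rw [Real.logb_mul (by positivity) (by positivity), Real.logb_rpow (by norm_num) (by norm_num),
    Real.logb_rpow_eq_mul_logb_of_pos (by linarith)] at h3
  nlinarith

end MobileAgent

open MobileAgent
theorem mainTheorem4 (c : ℝ) (hc : 1 ≤ c) :
    ∃ K : ℝ, ∀ (V A : Type*) [Fintype V] [DecidableEq V] [Fintype A] [DecidableEq A]
      (G : SimpleGraph V) [DecidableRel G.Adj] (π : PortNumbering G) (home : A ≃ V)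
      (ID : A → ℕ) (lam : ℕ) (root : A) (sel : FloodState → Finset ℕ → ℕ)
      (m L T : ℕ) (run : ℕ → Config A V FloodState),
      G.Connected → Function.Injective ID → IsGreatest (Set.range ID) lam →
      (lam : ℝ) ≤ (Fintype.card V : ℝ) ^ c → IsSelection sel →
      m = G.edgeFinset.card → L = idWidth lam → T = 8 * m * L →
      run = (floodingBFS sel).run π home (fun a => ⟨ID a, lam, m, decide (a = root)⟩) →
      -- the meeting protocol: adjacent agents meet, whatever the others are trying to do
      (∀ (target : A → Option ℕ) (meet : ℕ → Config A V MeetState),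
        meet = meetingProgram.run π home (fun a => ⟨ID a, lam, target a⟩) →
        (∀ a b p, target a = some p → (π.dest (home a) p).map Subtype.val = some (home b) →
          ∃ t < 4 * L, (meet t).pos a = home b ∧ (meet t).pos b = home b) ∧
        ∀ a, (meet (4 * L)).pos a = home a) ∧
      -- so do they in each of the `2 * m` executions of the protocol by the flooding algorithm
      (∀ k < 2 * m, ∀ a b p, ((run (k * (4 * L) + 1)).state a).target = some p →
        (π.dest (home a) p).map Subtype.val = some (home b) →
        ∃ t, k * (4 * L) < t ∧ t < (k + 1) * (4 * L) ∧
          (run t).pos a = home b ∧ (run t).pos b = home b) ∧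
      -- the algorithm has halted after `T` rounds, which is `O(m log λ)`
      (∀ t ≥ T, ∀ a, (run t).pos a = home a ∧ (run t).state a = (run T).state a) ∧
      (2 ≤ lam → (T : ℝ) ≤ 16 * m * Real.logb 2 lam) ∧
      -- its output is correct
      (∀ a, ((run T).state a).level = some (G.dist (home root) (home a))) ∧
      ((run T).state root).parent = none ∧
      (∀ a, a ≠ root → ∃ p w, ((run T).state a).parent = some p ∧
        π.dest (home a) p = some w ∧
        G.dist (home root) (home a) = G.dist (home root) w.1 + 1) ∧
      IsBFSTree G (parentGraph π home (run T).state) (home root) ∧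
      -- memory
      (2 ≤ Fintype.card V → ∀ t a,
        ((floodingBFS sel).memoryBits (run t) a : ℝ) ≤ K * Real.logb 2 (Fintype.card V)) := by
  -- Each of the nine stored numbers takes `2 * size + 1` bits, and its size is at most
  -- `(c + 7) * logb 2 n`.
  refine ⟨9 * (2 * c + 15), ?_⟩
  intro V A _ _ _ _ G _ π home ID lam root sel m L T run hG hID hlam hlamc hsel hm hL hT hrun
  have hle : ∀ a, ID a ≤ lam := fun a => hlam.2 ⟨a, rfl⟩
  have hrun' : run = floodRun sel π home ID lam m root := hrun
  obtain rfl : T = 2 * m * (4 * L) := by rw [hT]; ring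
  clear hrun hT
  subst hL hrun'
  have hroot := ((isSound_floodRun sel π home ID lam m root hsel hG le_rfl root).of_root rfl).2
  have hparent := floodRun_parent_final (π := π) (home := home) (root := root) hsel hG hID hle hm
  refine ⟨?_, ?_, ?_, ?_, floodRun_level_final hsel hG hID hle hm, hroot, hparent,
    isBFSTree_parentGraph hroot hparent, ?_⟩
  · rintro target _ rfl
    refine ⟨fun a b p hp hd => ?_, fun a => ?_⟩
    · obtain ⟨w, -, hwb⟩ := Option.map_eq_some_iff.1 hd
      have hne : ID a ≠ ID b := by
        intro h
        obtain rfl := hID h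
        exact w.2.ne hwb.symm
      exact meetingProgram_meets π home (fun a => ⟨ID a, lam, target a⟩) rfl (hle a) (hle b) hne
        hp hd
    · exact (meetingProgram_run π home (fun a => ⟨ID a, lam, target a⟩) a _ le_rfl).2.1
        (by dsimp only; omega)
  · exact fun k hk a b p ht hd => floodRun_meets hsel hID hle hk ht hd
  · exact fun t ht a => floodRun_halted a ht
  · intro h2
    have := size_le_two_mul_logb h2
    have hm0 : (0 : ℝ) ≤ m := m.cast_nonneg
    push_cast [idWidth]
    nlinarith
  · intro hn t a
    have h1 : ((floodingBFS sel).memoryBits (floodRun sel π home ID lam m root t) a : ℝ) ≤ _ :=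
      Nat.cast_le.2 (memoryBits_floodRun_le hsel hG hle hm t a)
    have h2 := size_register_bound_le hc hn hlamc
    have h3 : 1 ≤ Real.logb 2 (Fintype.card V : ℝ) := by
      rw [Real.le_logb_iff_rpow_le (by norm_num) (by positivity)]
      simpa using (show (2 : ℝ) ≤ Fintype.card V by exact_mod_cast hn)
    refine h1.trans ?_
    rw [Nat.cast_mul, Nat.cast_add, Nat.cast_mul]
    simp only [Nat.cast_ofNat, Nat.cast_one]
    nlinarith
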